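/- Let $X$ be a (Hausdorff) real locally convex space with topological dual $X^*$, and let $\{f_t\}_{t\in T}$ be an arbitrary family of proper, lower semicontinuous, convex functions $f_t:X\to[-\infty,+\infty]$, with pointwise supremum $f:=\sup_{t\in T}f_t$. For $g:X\to[-\infty,+\infty]$, $\gamma\ge 0$ and $x\in X$ let $$\partial_\gamma g(x):=\{x^*\in X^*:\ \langle x^*,y-x\rangle\le g(y)-g(x)+\gamma\ \text{ for all } y\in X\}$$ if $g(x)$ is finite, and $\partial_\gamma g(x):=\emptyset$ otherwise; put $\partial g:=\partial_0 g$. Let $\operatorname{dom} g:=\{x\in X: g(x)<+\infty\}$. For $A\subseteq X$ let $\mathrm N_A(x):=\partial\delta_A(x)$, where $\delta_A$ is $0$ on $A$ and $+\infty$ elsewhere. Let $T_\gamma(x):=\{t\in T: f_t(x)\ge f(x)-\gamma\}$, and let $\mathcal F_x$ be the family of all finite-dimensional linear subspaces of $X$ containing $x$. Then, for every $x\in X$, $$\partial f(x)=\bigcap_{L\in\mathcal F_x,\ \gamma>0}\operatorname{cl}^{w^*}\Bigl\{\operatorname{co}\Bigl(\bigcup_{t\in T_\gamma(x)}\partial_\gamma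 f_t(x)\Bigr)+\mathrm N_{\operatorname{dom} f\cap L}(x)\Bigr\},$$ where $\operatorname{co}$ denotes the convex hull and $\operatorname{cl}^{w^*}$ the closure in the weak$^*$ topology $w(X^*,X)$. -/

import Mathlib

open scoped Pointwise

namespace SupSubdiff

noncomputable section

/-- The effective domain of an extended-real-valued function. -/
def effDom {X : Type*} (f : X → EReal) : Set X :=
  {x | f x < ⊤}

/-- The epigraph of an extended-real-valued function, a subset of `X × ℝ`. -/
def epi {X : Type*} (f : X → EReal) : Set (X × ℝ) :=
  {p | f p.1 ≤ (p.2 : EReal)}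

/-- The class of proper lower semicontinuous convex functions `X → [-∞, +∞]`;
convexity means convexity of the epigraph. -/
structure IsGammaZero {X : Type*} [AddCommGroup X] [Module ℝ X] [TopologicalSpace X]
    (f : X → EReal) : Prop where
  dom_nonempty : (effDom f).Nonempty
  ne_bot : ∀ x, f x ≠ ⊥
  lsc : LowerSemicontinuous f
  convex : Convex ℝ (epi f)

/-- The `ε`-subdifferential of `f` at `x`, a subset of the topological dual of `X` (which carries
the weak-* topology); it is empty where `f x` is not finite. -/
def epsSubdiff {X : Type*} [AddCommGroup X] [Module ℝ X] [TopologicalSpace X]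
    (ε : ℝ) (f : X → EReal) (x : X) : Set (WeakDual ℝ X) :=
  {φ | f x ≠ ⊤ ∧ f x ≠ ⊥ ∧ ∀ y, ((φ (y - x) : ℝ) : EReal) ≤ f y - f x + (ε : EReal)}

/-- The Moreau-Rockafellar subdifferential. -/
def subdiff {X : Type*} [AddCommGroup X] [Module ℝ X] [TopologicalSpace X]
    (f : X → EReal) (x : X) : Set (WeakDual ℝ X) :=
  epsSubdiff 0 f x

open Classical in
/-- The indicator function of convex analysis: `0` on `A` and `+∞` off `A`. -/
def indicatorFun {X : Type*} (A : Set X) (x : X) : EReal :=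
  if x ∈ A then 0 else ⊤

/-- The `ε`-normal set of `A` at `x`: the `ε`-subdifferential of the indicator of `A`. -/
def epsNormal {X : Type*} [AddCommGroup X] [Module ℝ X] [TopologicalSpace X]
    (ε : ℝ) (A : Set X) (x : X) : Set (WeakDual ℝ X) :=
  epsSubdiff ε (indicatorFun A) x

/-- The normal cone of `A` at `x` (empty if `x ∉ A`). -/
def normalCone {X : Type*} [AddCommGroup X] [Module ℝ X] [TopologicalSpace X]
    (A : Set X) (x : X) : Set (WeakDual ℝ X) :=
  epsNormal 0 A x

/-- The pointwise supremum of a family of functions. -/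
def supFun {X T : Type*} (f : T → X → EReal) (x : X) : EReal :=
  ⨆ t, f t x

/-- The set of `ε`-active indices at `x`. -/
def activeIdx {X T : Type*} (f : T → X → EReal) (ε : ℝ) (x : X) : Set T :=
  {t | supFun f x - (ε : EReal) ≤ f t x}

/-- The family of finite-dimensional linear subspaces of `X` containing `x`. -/
def finDimThrough {X : Type*} [AddCommGroup X] [Module ℝ X] (x : X) : Set (Submodule ℝ X) :=
  {L | FiniteDimensional ℝ L ∧ x ∈ L}

end

end SupSubdiff

/-! The inclusion of `∂f(x)` in the intersection goes by contradiction. If `φ ∈ ∂f(x)` lies outside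
one closure, a vector `v` of `X` separates them strictly. Normals form a cone, so none is positive
at `v`, and by polarity `v` is a limit of feasible directions of `dom f ∩ L` at `x`. As `L` is
finite-dimensional, a small push along a relative interior direction gives a feasible `z` that still
separates: for some `β < φ z`, all `γ`-subgradients of active `f_t` are below `β` at `z`. By
Hahn-Banach (`exists_mem_epsSubdiff_lt_apply`) each active `f_t` then meets, on the ray `x + ℝ₊ z`,
the line of slope `β` starting at height `f(x) - γ`. These points depend on `t`, but convexity
trades the margin `γ` for a common `s > 0` with `f(x + s z) ≤ f(x) + s β`
(`exists_supFun_le_of_forall_exists_le`), against `φ ∈ ∂f(x)`.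

For the converse, `γ`-subgradients at `γ`-active indices are `2γ`-subgradients of `f`; on `L` this
survives convex hulls, adding normals and weak-* limits. Take `L = span {x, y}` and let `γ → 0`. -/

open Set

namespace SupSubdiff

/-! ### Extended-real epigraphs and subgradients via real bounds -/

section EReal

variable {X T : Type*}

theorem supFun_le_iff {f : T → X → EReal} {x : X} {c : EReal} :
    supFun f x ≤ c ↔ ∀ t, f t x ≤ c :=
  iSup_le_iff

theorem exists_real_ge_of_mem_effDom {g : X → EReal} {y : X} (hy : y ∈ effDom g) :
    ∃ b : ℝ, g y ≤ b := by
  obtain ⟨b, hb, -⟩ := EReal.lt_iff_exists_real_btwn.1 (show g y < ⊤ from hy)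
  exact ⟨b, hb.le⟩

theorem mem_effDom_of_le {g : X → EReal} {y : X} {b : ℝ} (h : g y ≤ b) : y ∈ effDom g :=
  h.trans_lt (EReal.coe_lt_top b)

theorem isClosed_epi [TopologicalSpace X] {g : X → EReal}
    (hg : LowerSemicontinuous g) : IsClosed (epi g) := by
  have h : epi g = (fun p : X × ℝ => (p.1, (p.2 : EReal))) ⁻¹' {p | g p.1 ≤ p.2} := rfl
  rw [h]
  exact hg.isClosed_epigraph.preimage
    (continuous_fst.prodMk (continuous_coe_real_ereal.comp continuous_snd))

variable [AddCommGroup X] [Module ℝ X]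

theorem le_coe_combo_of_convex_epi {g : X → EReal} (hg : Convex ℝ (epi g)) {y z : X} {p q θ : ℝ}
    (hy : g y ≤ p) (hz : g z ≤ q) (h0 : 0 ≤ θ) (h1 : θ ≤ 1) :
    g ((1 - θ) • y + θ • z) ≤ (((1 - θ) * p + θ * q : ℝ) : EReal) :=
  hg (x := (y, p)) hy (y := (z, q)) hz (sub_nonneg.2 h1) h0 (by ring)

theorem convex_epi_supFun {f : T → X → EReal} (hf : ∀ t, Convex ℝ (epi (f t))) :
    Convex ℝ (epi (supFun f)) := by
  have h : epi (supFun f) = ⋂ t, epi (f t) := by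
    ext p
    simp [epi, supFun_le_iff]
  rw [h]
  exact convex_iInter hf

variable [TopologicalSpace X]

/-- Real upper bounds of `g y` replace its value, so that later estimates avoid extended arithmetic.
-/
theorem mem_epsSubdiff_iff {g : X → EReal} {x : X} {a ε : ℝ} (ha : g x = a) {φ : WeakDual ℝ X} :
    φ ∈ epsSubdiff ε g x ↔ ∀ (y : X) (b : ℝ), g y ≤ b → φ (y - x) ≤ b - a + ε := by
  simp only [epsSubdiff, mem_ofPred_eq, ha, ne_eq, EReal.coe_ne_top, not_false_eq_true,
    EReal.coe_ne_bot, true_and]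
  constructor
  · intro h y b hb
    have h2 : ((φ (y - x) : ℝ) : EReal) ≤ (b : EReal) - a + ε :=
      (h y).trans (add_le_add_left (EReal.sub_le_sub hb le_rfl) _)
    exact_mod_cast h2
  · intro h y
    induction hy : g y using EReal.rec with
    | bot =>
      have := h y (φ (y - x) + a - ε - 1) (by rw [hy]; exact bot_le)
      linarith
    | top => simp
    | coe b =>
      have := h y b hy.le
      exact_mod_cast this

theorem mem_normalCone_iff {A : Set X} {x : X} (hx : x ∈ A) {φ : WeakDual ℝ X} :
    φ ∈ normalCone A x ↔ ∀ y ∈ A, φ (y - x) ≤ 0 := by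
  have ha : indicatorFun A x = ((0 : ℝ) : EReal) := by simp [indicatorFun, hx]
  rw [normalCone, epsNormal, mem_epsSubdiff_iff ha]
  constructor
  · intro h y hy
    simpa using h y 0 (by simp [indicatorFun, hy])
  · intro h y b hb
    by_cases hy : y ∈ A
    · have hb0 : (0 : ℝ) ≤ b := by simpa [indicatorFun, hy] using hb
      linarith [h y hy]
    · simp [indicatorFun, hy] at hb

end EReal

/-! ### Hahn-Banach separation and convex cones -/

section Separation

variable {X : Type*} [AddCommGroup X] [Module ℝ X] [TopologicalSpace X]

/-- Separation of a point from a closed convex set in the weak-* topology by an evaluation. -/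
theorem exists_apply_lt_of_notMem_closure {A : Set (WeakDual ℝ X)} (hA : Convex ℝ A)
    {φ : WeakDual ℝ X} (hφ : φ ∉ closure A) : ∃ (v : X) (u : ℝ), (∀ ψ ∈ A, ψ v < u) ∧ u < φ v := by
  have : LocallyConvexSpace ℝ (WeakDual ℝ X) :=
    inferInstanceAs (LocallyConvexSpace ℝ (WeakBilin (topDualPairing ℝ X)))
  obtain ⟨F, u, hF, hu⟩ := geometric_hahn_banach_closed_point hA.closure isClosed_closure hφ
  -- Weak-* continuous functionals are evaluations at points of `X`.
  obtain ⟨v, hv⟩ := LinearMap.dualEmbedding_surjective (topDualPairing ℝ X) F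
  have hFv : ∀ ψ : WeakDual ℝ X, F ψ = ψ v := fun ψ => by rw [← hv]; rfl
  exact ⟨v, u, fun ψ hψ => hFv ψ ▸ hF ψ (subset_closure hψ), hFv φ ▸ hu⟩

variable [IsTopologicalAddGroup X] [ContinuousSMul ℝ X]

/-- If a ray issued from `(x, g x - ε)` with slope `β` in the direction `v` misses the epigraph
of `g`, then some `ε`-subgradient of `g` at `x` is larger than any given `α < β` at `v`. -/
theorem exists_mem_epsSubdiff_lt_apply [LocallyConvexSpace ℝ X] {g : X → EReal}
    (hg : IsGammaZero g) {x v : X} {a ε α β : ℝ} (ha : g x = a) (hε : 0 < ε) (hαβ : α < β)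
    (h : ∀ r : ℝ, 0 ≤ r → ¬ g (x + r • v) ≤ ((a - ε + r * β : ℝ) : EReal)) :
    ∃ φ ∈ epsSubdiff ε g x, α < φ v := by
  -- With this `R` the ray reaches height `a + R * α`: it has caught up with the line of slope `α`
  -- through `(x, a)`. Only this compact segment is needed.
  set R : ℝ := ε / (β - α) with hR
  have hβα : 0 < β - α := sub_pos.2 hαβ
  have hR0 : 0 < R := div_pos hε hβα
  have hRε : R * (β - α) = ε := div_mul_cancel₀ _ hβα.ne'
  have hdisj : Disjoint (epi g) (segment ℝ (x, a - ε) (x + R • v, a - ε + R * β)) := by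
    rw [Set.disjoint_left]
    intro p hp hps
    rw [segment_eq_image'] at hps
    obtain ⟨θ, hθ, rfl⟩ := hps
    refine h (θ * R) (mul_nonneg hθ.1 hR0.le) ?_
    have : g (x + θ • (x + R • v - x)) ≤ ((a - ε + θ * (a - ε + R * β - (a - ε)) : ℝ) : EReal) := hp
    convert this using 2
    · rw [add_sub_cancel_left, smul_smul]
    · ring
  have hcomp : IsCompact (segment ℝ (x, a - ε) (x + R • v, a - ε + R * β)) := by
    rw [segment_eq_image']
    exact isCompact_Icc.image (by fun_prop)
  obtain ⟨F, u, w, hFu, huw, hFw⟩ := geometric_hahn_banach_closed_compact hg.convex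
    (isClosed_epi hg.lsc) (convex_segment _ _) hcomp hdisj
  set c : ℝ := F (0, 1) with hc
  have hF : ∀ (y : X) (r : ℝ), F (y, r) = F (y, 0) + r * c := by
    intro y r
    have : ((y, r) : X × ℝ) = (y, 0) + r • (0, 1) := by simp
    rw [this, map_add, map_smul, smul_eq_mul]
  have hx : F (x, a) < u := hFu (x, a) (by simp [epi, ha])
  have hx1 : w < F (x, a - ε) := hFw _ (left_mem_segment ℝ _ _)
  have hx2 : w < F (x + R • v, a - ε + R * β) := hFw _ (right_mem_segment ℝ _ _)
  rw [hF] at hx hx1 hx2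
  -- `(x, a)` and `(x, a - ε)` are strictly separated, so the hyperplane is not vertical.
  have hc0 : c < 0 := by
    by_contra hcc
    have := mul_nonneg hε.le (not_lt.1 hcc)
    nlinarith
  let G : StrongDual ℝ X := F.comp (ContinuousLinearMap.inl ℝ X ℝ)
  have hG : ∀ y, G y = F (y, 0) := fun y => rfl
  let φ : WeakDual ℝ X := StrongDual.toWeakDual ((-c)⁻¹ • G)
  have hφ : ∀ y, -c * φ y = F (y, 0) := by
    intro y
    have : φ y = (-c)⁻¹ * F (y, 0) := rfl
    rw [this, mul_inv_cancel_left₀ (neg_ne_zero.2 hc0.ne)]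
  refine ⟨φ, (mem_epsSubdiff_iff ha).2 fun y b hb => ?_, ?_⟩
  · have hy : F (y, b) < u := hFu (y, b) hb
    rw [hF, ← hφ] at hy
    rw [← hφ] at hx1
    rw [map_sub]
    have : -c * (φ y - φ x) < -c * (b - a + ε) := by nlinarith
    exact (lt_of_mul_lt_mul_left this (neg_nonneg.2 hc0.le)).le
  · rw [← hφ] at hx hx2
    rw [map_add, map_smul, smul_eq_mul] at hx2
    have h1 : -c * (R * α) < -c * (R * φ v) := by
      have : R * α = R * β - ε := by linarith
      rw [this]
      nlinarith
    exact lt_of_mul_lt_mul_left (lt_of_mul_lt_mul_left h1 (neg_nonneg.2 hc0.le)) hR0.le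

/-- A convex cone in a finite-dimensional space contains a point `w` in its relative interior:
every point of the closure is moved into the cone by adding a positive multiple of `w`. -/
theorem exists_mem_add_smul_mem_of_closure [T2Space X] {K : Set X} (h0 : (0 : X) ∈ K)
    (hadd : ∀ y ∈ K, ∀ z ∈ K, y + z ∈ K) (hsmul : ∀ r : ℝ, 0 ≤ r → ∀ y ∈ K, r • y ∈ K)
    {L : Submodule ℝ X} [FiniteDimensional ℝ L] (hKL : K ⊆ L) :
    ∃ w ∈ K, ∀ v ∈ closure K, ∀ ε : ℝ, 0 < ε → v + ε • w ∈ K := by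
  obtain ⟨t, htK, htspan, htli⟩ := exists_linearIndependent ℝ K
  let S : Submodule ℝ X := Submodule.span ℝ (range ((↑) : t → X))
  let b : Module.Basis t ℝ S := Module.Basis.span htli
  have hSL : S ≤ L := by
    refine Submodule.span_le.2 ?_
    rintro _ ⟨i, rfl⟩
    exact hKL (htK i.2)
  have : FiniteDimensional ℝ S := Submodule.finiteDimensional_of_le hSL
  have : Fintype t := FiniteDimensional.fintypeBasisIndex b
  have hKS : K ⊆ S := by
    have : S = Submodule.span ℝ K := by rw [← htspan, ← Subtype.range_coe (s := t)]
    rw [this]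
    exact Submodule.subset_span
  have hb : ∀ i, ((b i : S) : X) = i := fun i =>
    congrArg Subtype.val (Module.Basis.span_apply htli i)
  have hsum : ∀ s : Finset t, ∀ c : t → ℝ, (∀ i, 0 ≤ c i) → ∑ i ∈ s, c i • (i : X) ∈ K := by
    intro s c hc
    exact Finset.sum_induction _ (· ∈ K) (fun y z hy hz => hadd y hy z hz) h0
      (fun i _ => hsmul _ (hc i) _ (htK i.2))
  refine ⟨∑ i : t, (i : X), ?_, fun v hv ε hε => ?_⟩
  · simpa using hsum Finset.univ (fun _ => 1) (fun _ => zero_le_one)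
  have hvS : v ∈ S := closure_minimal hKS S.closed_of_finiteDimensional hv
  have hv' : (⟨v, hvS⟩ : S) ∈ closure ((↑) ⁻¹' K : Set S) := by
    have himg : ((↑) '' ((↑) ⁻¹' K : Set S) : Set X) = K := by
      rw [image_preimage_eq_inter_range, Subtype.range_coe]
      exact inter_eq_left.2 hKS
    rw [closure_subtype, himg]
    exact hv
  -- A point `y` of `K` in this neighbourhood of `v` differs from `v + ε • w` by a nonnegative
  -- combination of basis vectors taken from `K`.
  have hopen : IsOpen {y : S | ∀ i, b.coord i y < b.coord i ⟨v, hvS⟩ + ε} := by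
    simp only [ofPred_forall]
    exact isOpen_iInter_of_finite fun i =>
      isOpen_lt (b.coord i).continuous_of_finiteDimensional continuous_const
  obtain ⟨y, hy, hyK⟩ := mem_closure_iff.1 hv' _ hopen fun i => by linarith
  have hrepr : ∀ z : S, (z : X) = ∑ i, b.coord i z • (i : X) := by
    intro z
    conv_lhs => rw [← b.sum_repr z]
    simp only [AddSubmonoidClass.coe_finsetSum, Submodule.coe_smul, hb, Module.Basis.coord_apply]
  have key : v + ε • ∑ i : t, (i : X)
      = y + ∑ i, (b.coord i ⟨v, hvS⟩ + ε - b.coord i y) • (i : X) := by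
    rw [hrepr y]
    conv_lhs => rw [show v = ((⟨v, hvS⟩ : S) : X) from rfl, hrepr ⟨v, hvS⟩]
    rw [Finset.smul_sum, ← Finset.sum_add_distrib, ← Finset.sum_add_distrib]
    refine Finset.sum_congr rfl fun i _ => ?_
    rw [← add_smul, ← add_smul]
    congr 1
    ring
  rw [key]
  exact hadd _ hyK _ (hsum _ _ fun i => sub_nonneg.2 (hy i).le)

/-- A point at which every functional that is nonpositive on a convex cone is nonpositive
belongs to the closure of the cone. -/
theorem mem_closure_of_forall_polar [LocallyConvexSpace ℝ X] {K : Set X} (h0 : (0 : X) ∈ K)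
    (hadd : ∀ y ∈ K, ∀ z ∈ K, y + z ∈ K) (hsmul : ∀ r : ℝ, 0 ≤ r → ∀ y ∈ K, r • y ∈ K) {v : X}
    (hv : ∀ φ : WeakDual ℝ X, (∀ y ∈ K, φ y ≤ 0) → φ v ≤ 0) : v ∈ closure K := by
  by_contra hvK
  have hconv : Convex ℝ K := fun y hy z hz r s hr hs _ =>
    hadd _ (hsmul r hr y hy) _ (hsmul s hs z hz)
  obtain ⟨F, u, hF, hu⟩ := geometric_hahn_banach_closed_point hconv.closure isClosed_closure hvK
  have hF' : ∀ y ∈ K, F y < u := fun y hy => hF y (subset_closure hy)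
  have hu0 : 0 < u := by simpa using hF' 0 h0
  have h := hv (StrongDual.toWeakDual F) fun y hy => by
    by_contra! hpos
    have hpos : 0 < F y := hpos
    have := hF' _ (hsmul (u / F y) (by positivity) y hy)
    rw [map_smul, smul_eq_mul, div_mul_cancel₀ _ hpos.ne'] at this
    exact this.false
  have h : F v ≤ 0 := h
  linarith

end Separation

/-! ### Subgradients of the supremum -/

section Supremum

variable {X T : Type*} [AddCommGroup X] [Module ℝ X]

/-- If each member of a family of convex functions lies at some point of the ray `x + ℝ₊ v` below
the line of slope `α` lowered by `γ`, then the supremum lies somewhere on the open ray below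
the line of slope `α`. -/
theorem exists_supFun_le_of_forall_exists_le {f : T → X → EReal}
    (hf : ∀ t, Convex ℝ (epi (f t))) {x v : X} {a b α γ r : ℝ} (hx : supFun f x ≤ a) (hγ : 0 < γ)
    (hr : 0 < r) (hb : supFun f (x + r • v) ≤ b)
    (h : ∀ t, ∃ σ : ℝ, 0 ≤ σ ∧ f t (x + σ • v) ≤ ((a - γ + σ * α : ℝ) : EReal)) :
    ∃ s : ℝ, 0 < s ∧ supFun f (x + s • v) ≤ ((a + s * α : ℝ) : EReal) := by
  rw [supFun_le_iff] at hx hb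
  have hcombo : ∀ t (σ τ θ p q : ℝ), f t (x + σ • v) ≤ p → f t (x + τ • v) ≤ q → 0 ≤ θ → θ ≤ 1 →
      f t (x + ((1 - θ) * σ + θ * τ) • v) ≤ (((1 - θ) * p + θ * q : ℝ) : EReal) := by
    intro t σ τ θ p q hp hq h0 h1
    have := le_coe_combo_of_convex_epi (hf t) hp hq h0 h1
    convert this using 2
    module
  -- If `σ < s`, interpolating between `σ` and `r` exceeds the target by at most `s * M - γ`, whence
  -- `s ≤ γ / M`. If `s ≤ σ`, interpolating between `0` and `σ` suffices.
  set M : ℝ := |α| + (|b - a| + γ + r * |α|) / r with hM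
  have hM0 : 0 < M := by positivity
  set s : ℝ := min r (γ / M) with hs
  have hs0 : 0 < s := lt_min hr (div_pos hγ hM0)
  have hsr : s ≤ r := min_le_left _ _
  have hsM : s * M ≤ γ := (le_div_iff₀ hM0).1 (min_le_right _ _)
  refine ⟨s, hs0, supFun_le_iff.2 fun t => ?_⟩
  obtain ⟨σ, hσ0, hσ⟩ := h t
  rcases le_or_gt s σ with hle | hlt
  · have hσpos : 0 < σ := hs0.trans_le hle
    set θ := s / σ with hθ
    have hθσ : θ * σ = s := div_mul_cancel₀ _ hσpos.ne'
    have hθ0 : 0 ≤ θ := by positivity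
    have h1 := hcombo t 0 σ θ a _ (by simpa using hx t) hσ hθ0 ((div_le_one hσpos).2 hle)
    rw [mul_zero, zero_add, hθσ] at h1
    refine h1.trans (EReal.coe_le_coe_iff.2 ?_)
    rw [← hθσ]
    nlinarith [mul_nonneg hθ0 hγ.le]
  · have hd : 0 < r - σ := by linarith
    set θ := (s - σ) / (r - σ) with hθ
    have hθd : θ * (r - σ) = s - σ := div_mul_cancel₀ _ hd.ne'
    have hθ0 : 0 ≤ θ := div_nonneg (by linarith) hd.le
    have hθ1 : θ ≤ 1 := (div_le_one hd).2 (by linarith)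
    have hθr : θ ≤ s / r := by
      rw [hθ, div_le_div_iff₀ hd hr]
      nlinarith
    have h1 := hcombo t σ r θ _ b hσ (hb t) hθ0 hθ1
    have h2 : (1 - θ) * σ + θ * r = s := by linarith
    rw [h2] at h1
    refine h1.trans (EReal.coe_le_coe_iff.2 ?_)
    have e1 : (σ - s) * α ≤ s * |α| := by
      have : (σ - s) * α ≤ |σ - s| * |α| := by rw [← abs_mul]; exact le_abs_self _
      refine this.trans (mul_le_mul_of_nonneg_right ?_ (abs_nonneg α))
      rw [abs_le]
      constructor <;> linarith
    have e2 : b - a + γ - σ * α ≤ |b - a| + γ + r * |α| := by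
      have h3 : -(σ * α) ≤ σ * |α| := by
        rw [← mul_neg]
        exact mul_le_mul_of_nonneg_left (neg_le_abs α) hσ0
      have h4 : σ * |α| ≤ r * |α| := mul_le_mul_of_nonneg_right (by linarith) (abs_nonneg α)
      linarith [le_abs_self (b - a)]
    have e3 : θ * (b - a + γ - σ * α) ≤ s / r * (|b - a| + γ + r * |α|) :=
      (mul_le_mul_of_nonneg_left e2 hθ0).trans
        (mul_le_mul_of_nonneg_right hθr (by positivity))
    have e4 : s * M = s * |α| + s / r * (|b - a| + γ + r * |α|) := by
      rw [hM]
      ring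
    linarith

variable [TopologicalSpace X]

/-- The members of the closure attached to `γ` and `L` are `2γ`-subgradients of the supremum
as far as points of `L` are concerned. -/
theorem apply_sub_le_of_mem_closure {f : T → X → EReal} {x y : X} {a b γ : ℝ}
    (hx : supFun f x = a) (hy : supFun f y ≤ b) {L : Submodule ℝ X} (hxL : x ∈ L) (hyL : y ∈ L)
    (hf : ∀ t, f t x ≠ ⊥) {φ : WeakDual ℝ X}
    (hφ : φ ∈ closure (convexHull ℝ (⋃ t ∈ activeIdx f γ x, epsSubdiff γ (f t) x) +
      normalCone (effDom (supFun f) ∩ (L : Set X)) x)) :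
    φ (y - x) ≤ b - a + 2 * γ := by
  have hclosed : IsClosed {ψ : WeakDual ℝ X | ψ (y - x) ≤ b - a + 2 * γ} :=
    isClosed_le (WeakDual.eval_continuous (y - x)) continuous_const
  refine closure_minimal ?_ hclosed hφ
  intro η hη
  obtain ⟨ψ, hψ, ν, hν, rfl⟩ := Set.mem_add.1 hη
  have hν0 : ν (y - x) ≤ 0 :=
    (mem_normalCone_iff (mem_inter (mem_effDom_of_le hx.le) hxL)).1 hν y
      ⟨mem_effDom_of_le hy, hyL⟩
  have hψ0 : ψ ∈ {ψ : WeakDual ℝ X | ψ (y - x) ≤ b - a + 2 * γ} := by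
    refine convexHull_min ?_ ?_ hψ
    · refine iUnion₂_subset fun t ht ψ hψ => ?_
      obtain ⟨c, hc⟩ : ∃ c : ℝ, f t x = c :=
        ⟨(f t x).toReal, (EReal.coe_toReal hψ.1 (hf t)).symm⟩
      have hca : a - γ ≤ c := by
        have : supFun f x - (γ : EReal) ≤ f t x := ht
        rw [hx, hc] at this
        exact_mod_cast this
      have := (mem_epsSubdiff_iff hc).1 hψ y b (supFun_le_iff.1 hy t)
      simp only [mem_ofPred_eq]
      linarith
    · intro ψ₁ h₁ ψ₂ h₂ r s hr hs hrs
      simp only [mem_ofPred_eq] at h₁ h₂ ⊢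
      have : (r • ψ₁ + s • ψ₂) (y - x) = r * ψ₁ (y - x) + s * ψ₂ (y - x) := rfl
      rw [this]
      calc r * ψ₁ (y - x) + s * ψ₂ (y - x)
          ≤ r * (b - a + 2 * γ) + s * (b - a + 2 * γ) :=
            add_le_add (mul_le_mul_of_nonneg_left h₁ hr) (mul_le_mul_of_nonneg_left h₂ hs)
        _ = b - a + 2 * γ := by rw [← add_mul, hrs, one_mul]
  have hadd : (ψ + ν) (y - x) = ψ (y - x) + ν (y - x) := rfl
  simp only [mem_ofPred_eq] at hψ0 ⊢
  rw [hadd]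
  linarith

variable [IsTopologicalAddGroup X] [ContinuousSMul ℝ X] [LocallyConvexSpace ℝ X] [T2Space X]

/-- The hard inclusion; finite dimension of `L` serves to move the separating vector from the
closure of the feasible cone into the cone. -/
theorem subdiff_supFun_subset_closure {f : T → X → EReal} (hf : ∀ t, IsGammaZero (f t)) {x : X}
    {L : Submodule ℝ X} [FiniteDimensional ℝ L] (hxL : x ∈ L) {γ : ℝ} (hγ : 0 < γ) :
    subdiff (supFun f) x ⊆ closure
      (convexHull ℝ (⋃ t ∈ activeIdx f γ x, epsSubdiff γ (f t) x) +
        normalCone (effDom (supFun f) ∩ (L : Set X)) x) := by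
  intro φ hφ
  obtain ⟨a, ha⟩ : ∃ a : ℝ, supFun f x = a :=
    ⟨_, (EReal.coe_toReal hφ.1 hφ.2.1).symm⟩
  rw [subdiff, mem_epsSubdiff_iff ha] at hφ
  have hconvf := convex_epi_supFun fun t => (hf t).convex
  set C : Set X := effDom (supFun f) ∩ (L : Set X) with hC
  have hxC : x ∈ C := ⟨mem_effDom_of_le ha.le, hxL⟩
  have hconvC : Convex ℝ C := by
    refine Convex.inter ?_ L.convex
    intro y hy z hz r s hr hs hrs
    obtain ⟨p, hp⟩ := exists_real_ge_of_mem_effDom hy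
    obtain ⟨q, hq⟩ := exists_real_ge_of_mem_effDom hz
    have := le_coe_combo_of_convex_epi hconvf hp hq hs (by linarith)
    rw [← hrs, add_sub_cancel_right] at this
    exact mem_effDom_of_le this
  by_contra hcon
  have hNconv : Convex ℝ (normalCone C x) := by
    intro ν₁ h₁ ν₂ h₂ r s hr hs _
    rw [mem_normalCone_iff hxC] at h₁ h₂ ⊢
    intro y hy
    have : (r • ν₁ + s • ν₂) (y - x) = r * ν₁ (y - x) + s * ν₂ (y - x) := rfl
    rw [this]
    exact add_nonpos (mul_nonpos_of_nonneg_of_nonpos hr (h₁ y hy))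
      (mul_nonpos_of_nonneg_of_nonpos hs (h₂ y hy))
  obtain ⟨v, u, hu, huφ⟩ :=
    exists_apply_lt_of_notMem_closure ((convex_convexHull ℝ _).add hNconv) hcon
  have hval : ∀ t ∈ activeIdx f γ x, ∃ c : ℝ, f t x = c ∧ a - γ ≤ c ∧ c ≤ a := by
    intro t ht
    have h1 : ((a - γ : ℝ) : EReal) ≤ f t x := by
      have : supFun f x - (γ : EReal) ≤ f t x := ht
      rwa [ha] at this
    have h2 : f t x ≤ a := supFun_le_iff.1 ha.le t
    have hc : f t x = ((f t x).toReal : EReal) :=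
      (EReal.coe_toReal (h2.trans_lt (EReal.coe_lt_top a)).ne ((hf t).ne_bot x)).symm
    rw [hc, EReal.coe_le_coe_iff] at h1 h2
    exact ⟨_, hc, h1, h2⟩
  have hu' : ∀ t ∈ activeIdx f γ x, ∀ ψ ∈ epsSubdiff γ (f t) x, ∀ ν ∈ normalCone C x,
      ψ v + ν v < u := fun t ht ψ hψ ν hν =>
    hu (ψ + ν) (add_mem_add (subset_convexHull ℝ _ (mem_biUnion ht hψ)) hν)
  have h0N : (0 : WeakDual ℝ X) ∈ normalCone C x :=
    (mem_normalCone_iff hxC).2 fun y _ => le_rfl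
  obtain ⟨t₀, ht₀⟩ : ∃ t, t ∈ activeIdx f γ x := by
    have : ((a - γ : ℝ) : EReal) < ⨆ t, f t x := by
      change _ < supFun f x
      rw [ha, EReal.coe_lt_coe_iff]
      linarith
    obtain ⟨t, ht⟩ := lt_iSup_iff.1 this
    refine ⟨t, ?_⟩
    change supFun f x - (γ : EReal) ≤ f t x
    rw [ha]
    exact ht.le
  obtain ⟨c₀, hc₀, -, -⟩ := hval t₀ ht₀
  -- Direction `0`: only the existence of a `γ`-subgradient matters.
  obtain ⟨ψ₀, hψ₀, -⟩ := exists_mem_epsSubdiff_lt_apply (hf t₀) (v := (0 : X)) hc₀ hγ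
    (show (-1 : ℝ) < 0 by norm_num) (by
      intro r _
      rw [smul_zero, add_zero, hc₀, EReal.coe_le_coe_iff]
      linarith)
  let K : Set X := {z | ∃ r : ℝ, 0 < r ∧ x + r • z ∈ C}
  have h0K : (0 : X) ∈ K := ⟨1, one_pos, by simpa using hxC⟩
  have hsmulK : ∀ r : ℝ, 0 ≤ r → ∀ y ∈ K, r • y ∈ K := by
    rintro r hr y ⟨s, hs, hy⟩
    rcases hr.eq_or_lt with rfl | hr
    · simpa using h0K
    · refine ⟨s / r, div_pos hs hr, ?_⟩
      rwa [smul_smul, div_mul_cancel₀ _ hr.ne']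
  have haddK : ∀ y ∈ K, ∀ z ∈ K, y + z ∈ K := by
    rintro y ⟨r, hr, hy⟩ z ⟨s, hs, hz⟩
    refine ⟨r * s / (r + s), by positivity, ?_⟩
    have := hconvC hy hz (a := s / (r + s)) (b := r / (r + s)) (by positivity) (by positivity)
      (by field_simp; ring)
    convert this using 1
    have e : x = (s / (r + s) + r / (r + s)) • x := by
      rw [← add_div, add_comm s r, div_self (by positivity), one_smul]
    conv_lhs => rw [e]
    module
  have hKL : K ⊆ L := by
    rintro z ⟨r, hr, hz⟩
    have : r • z ∈ L := by simpa using L.sub_mem hz.2 hxL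
    exact (L.smul_mem_iff hr.ne').1 this
  have hνv : ∀ ν ∈ normalCone C x, ν v ≤ 0 := by
    intro ν hν
    by_contra! hpos
    set n : ℝ := |u - ψ₀ v| / ν v with hn
    have hn0 : 0 ≤ n := by positivity
    have hnν : n • ν ∈ normalCone C x := by
      rw [mem_normalCone_iff hxC] at hν ⊢
      exact fun y hy => mul_nonpos_of_nonneg_of_nonpos hn0 (hν y hy)
    have h1 : ψ₀ v + n * ν v < u := hu' t₀ ht₀ ψ₀ hψ₀ _ hnν
    rw [hn, div_mul_cancel₀ _ hpos.ne'] at h1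
    linarith [le_abs_self (u - ψ₀ v)]
  have hvK : v ∈ closure K := by
    refine mem_closure_of_forall_polar h0K haddK hsmulK fun ν hν => hνv ν ?_
    refine (mem_normalCone_iff hxC).2 fun y hy => hν _ ⟨1, one_pos, ?_⟩
    simpa using hy
  obtain ⟨w, hwK, hw⟩ := exists_mem_add_smul_mem_of_closure h0K haddK hsmulK hKL
  -- As `f` is finite at a point `x + r • w`, this bound is uniform in `t`, so a small multiple of
  -- `w` preserves the separation.
  obtain ⟨D, hD⟩ : ∃ D : ℝ, ∀ t ∈ activeIdx f γ x, ∀ ψ ∈ epsSubdiff γ (f t) x, ψ w ≤ D := by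
    obtain ⟨r, hr, hrC⟩ := hwK
    obtain ⟨b, hb⟩ := exists_real_ge_of_mem_effDom hrC.1
    refine ⟨(b - a + 2 * γ) / r, fun t ht ψ hψ => ?_⟩
    obtain ⟨c, hc, hca, -⟩ := hval t ht
    have := (mem_epsSubdiff_iff hc).1 hψ _ b (supFun_le_iff.1 hb t)
    rw [add_sub_cancel_left, map_smul, smul_eq_mul] at this
    rw [le_div_iff₀ hr]
    linarith
  obtain ⟨ε, hε, hεlt⟩ : ∃ ε : ℝ, 0 < ε ∧ u + ε * D < φ v + ε * φ w := by
    refine ⟨(φ v - u) / (2 * (|D - φ w| + 1)), by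
      have := sub_pos.2 huφ
      positivity, ?_⟩
    set q := (φ v - u) / (2 * (|D - φ w| + 1)) with hq
    have hq0 : 0 < q := by
      have := sub_pos.2 huφ
      positivity
    have h1 : q * (2 * (|D - φ w| + 1)) = φ v - u := div_mul_cancel₀ _ (by positivity)
    have h2 : q * (D - φ w) ≤ q * |D - φ w| := mul_le_mul_of_nonneg_left (le_abs_self _) hq0.le
    nlinarith [mul_nonneg hq0.le (abs_nonneg (D - φ w))]
  set z := v + ε • w with hz
  obtain ⟨r, hr, hrC⟩ := hw v hvK ε hε
  rw [← hz] at hrC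
  obtain ⟨b, hb⟩ := exists_real_ge_of_mem_effDom hrC.1
  obtain ⟨β, hβ1, hβ2⟩ := exists_between hεlt
  obtain ⟨s, hs, hsle⟩ := exists_supFun_le_of_forall_exists_le (fun t => (hf t).convex) (α := β)
    ha.le hγ hr hb (by
      intro t
      by_cases ht : t ∈ activeIdx f γ x
      · obtain ⟨c, hc, -, hca⟩ := hval t ht
        by_contra! hno
        obtain ⟨ψ, hψ, hψz⟩ := exists_mem_epsSubdiff_lt_apply (hf t) (v := z) hc hγ hβ1 (by
          intro σ hσ hle
          refine (hno σ hσ).not_ge (hle.trans (EReal.coe_le_coe_iff.2 ?_))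
          linarith)
        rw [hz, map_add, map_smul, smul_eq_mul] at hψz
        have h1 : ψ v + 0 < u := hu' t ht ψ hψ 0 h0N
        have h2 := mul_le_mul_of_nonneg_left (hD t ht ψ hψ) hε.le
        linarith
      -- An inactive `f t` is already below `a - γ` at `x`.
      · refine ⟨0, le_rfl, ?_⟩
        have : ¬ supFun f x - (γ : EReal) ≤ f t x := ht
        rw [ha, not_le] at this
        simpa using this.le)
  have hfin := hφ _ _ hsle
  rw [add_sub_cancel_left, hz, map_smul, map_add, map_smul, smul_eq_mul, smul_eq_mul] at hfin
  have := mul_lt_mul_of_pos_left hβ2 hs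
  linarith

end Supremum

end SupSubdiff

theorem mainTheorem11 {X : Type*} [AddCommGroup X] [Module ℝ X] [TopologicalSpace X]
    [IsTopologicalAddGroup X] [ContinuousSMul ℝ X] [LocallyConvexSpace ℝ X] [T2Space X]
    {T : Type*} (f : T → X → EReal) (hf : ∀ t, SupSubdiff.IsGammaZero (f t)) (x : X) :
    SupSubdiff.subdiff (SupSubdiff.supFun f) x =
      ⋂ L ∈ SupSubdiff.finDimThrough x, ⋂ γ ∈ Set.Ioi (0 : ℝ),
        closure
          (convexHull ℝ
              (⋃ t ∈ SupSubdiff.activeIdx f γ x, SupSubdiff.epsSubdiff γ (f t) x) +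
            SupSubdiff.normalCone
              (SupSubdiff.effDom (SupSubdiff.supFun f) ∩ (L : Set X)) x) := by
  apply Set.Subset.antisymm
  · refine Set.subset_iInter₂ fun L hL => Set.subset_iInter₂ fun γ hγ => ?_
    have : FiniteDimensional ℝ L := hL.1
    exact SupSubdiff.subdiff_supFun_subset_closure hf hL.2 hγ
  · intro φ hφ
    simp only [Set.mem_iInter] at hφ
    have hspan : ∀ y : X, Submodule.span ℝ {x, y} ∈ SupSubdiff.finDimThrough x := fun y =>
      ⟨FiniteDimensional.span_of_finite ℝ (Set.toFinite _), Submodule.subset_span (by simp)⟩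
    -- One member of one set suffices: `ψ` shows that `T` is nonempty, hence `f x ≠ ⊥`, and `ν` that
    -- `x ∈ dom f`.
    obtain ⟨_, ψ, hψ, ν, hν, -⟩ :=
      closure_nonempty_iff.1 ⟨φ, hφ _ (hspan x) 1 (Set.mem_Ioi.2 one_pos)⟩
    obtain ⟨_, hψ'⟩ := convexHull_nonempty_iff.1 ⟨ψ, hψ⟩
    obtain ⟨t, -, -⟩ := Set.mem_iUnion₂.1 hψ'
    have htop : SupSubdiff.supFun f x ≠ ⊤ := by
      intro htop
      refine hν.1 ?_
      simp [SupSubdiff.indicatorFun, SupSubdiff.effDom, htop]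
    have hbot : SupSubdiff.supFun f x ≠ ⊥ := fun hbot =>
      (hf t).ne_bot x (le_bot_iff.1 (SupSubdiff.supFun_le_iff.1 hbot.le t))
    have ha := (EReal.coe_toReal htop hbot).symm
    rw [SupSubdiff.subdiff, SupSubdiff.mem_epsSubdiff_iff ha]
    intro y b hb
    refine le_of_forall_pos_le_add fun δ hδ => ?_
    have := SupSubdiff.apply_sub_le_of_mem_closure ha hb (hspan y).2
      (Submodule.subset_span (by simp)) (fun t => (hf t).ne_bot x)
      (hφ _ (hspan y) (δ / 2) (Set.mem_Ioi.2 (half_pos hδ)))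
    linarith
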